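/- Let $(W,S)$ be a finite Coxeter system with length function $\ell$ and identity $e$. For $I\subseteq S$ let $W_I$ be the subgroup of $W$ generated by $I$, let $w_{\circ,I}$ be the longest element of $W_I$, and let $W^I=\{w\in W : \ell(ws)>\ell(w)\text{ for all } s\in I\}$. Let $\mathcal P_W=\{xW_I : I\subseteq S,\ x\in W\}$ be the set of all standard parabolic cosets (the Coxeter complex); every such coset can be written $xW_I$ with $x\in W^I$. The facial weak order is the partial order $\le$ on $\mathcal P_W$ that is the reflexive transitive closure of the following relations, where $I\subseteq S$, $s\in S$ and $x\in W^I$: (1) $xW_I \lessdot xW_{I\cup\{s\}}$ if $s\notin I$ and $x\in W^{I\cup\{s\}}$; (2) $xW_I \lessdot x\,w_{\circ,I}\,w_{\circ,I\setminus\{s\}}\,W_{I\setminus\{s\}}$ if $s\in I$. Let $\mu$ be the Möbius function of the poset $(\mathcal P_W,\le)$, that is, $\mu(p,p)=1$, $\mu(p,q)=-\sum_{p\le r<q}\mu(p,r)$ if $p<q$, and $\mu(p,q)=0$ otherwise. **Proposition (Möbius function of the facial weak order).** For all $J\subseteq S$ and $y\in W^J$, $$\mu(eW_\varnothing,\,yW_J)=\begin{cases}(-1)^{|J|}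 & \text{if } y=e,\\ 0 & \text{otherwise.}\end{cases}$$ -/

import Mathlib

open scoped Pointwise

noncomputable section

namespace FacialWeak

variable {B W : Type*} [Group W] {M : CoxeterMatrix B} (cs : CoxeterSystem M W)

/-! ### Parabolic cosets, the Coxeter complex and the facial weak order -/

/-- The set `S` of simple reflections, as a subset of `W`. -/
def simples : Set W := Set.range cs.simple

/-- The standard parabolic subgroup `W_I`: the subgroup of `W` generated by `I`. -/
abbrev parabolic (I : Set W) : Subgroup W := Subgroup.closure I

/-- `W^I`: the elements `w` with `ℓ(ws) > ℓ(w)` for all `s ∈ I`. -/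
def minReps (I : Set W) : Set W := {w | ∀ s ∈ I, cs.length w < cs.length (w * s)}


/-- In a finite Coxeter group, `W_I` has an element of maximal length. -/
theorem exists_longest [Finite W] (I : Set W) :
    ∃ w ∈ parabolic I, ∀ v ∈ parabolic I, cs.length v ≤ cs.length w := by
  obtain ⟨w, hw, h⟩ := Set.exists_max_image (parabolic I : Set W) cs.length
    (Set.toFinite _) ⟨1, one_mem _⟩
  exact ⟨w, hw, h⟩

/-- The longest element of the standard parabolic subgroup `W_I`. -/
def longest [Finite W] (I : Set W) : W := (exists_longest cs I).choose

theorem longest_mem [Finite W] (I : Set W) : longest cs I ∈ parabolic I :=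
  (exists_longest cs I).choose_spec.1

theorem length_le_longest [Finite W] (I : Set W) {v : W} (hv : v ∈ parabolic I) :
    cs.length v ≤ cs.length (longest cs I) :=
  (exists_longest cs I).choose_spec.2 v hv

/-- The Coxeter complex: the set of all standard parabolic cosets `x W_I` with `x ∈ W` and
`I ⊆ S`, as subsets of `W`. -/
def CoxeterComplex : Type _ :=
  {A : Set W // ∃ I ⊆ simples cs, ∃ x : W, A = x • (parabolic I : Set W)}

/-- The standard parabolic coset `x W_I`, as an element of the Coxeter complex. -/
def coset (x : W) (I : Set W) (hI : I ⊆ simples cs) : CoxeterComplex cs :=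
  ⟨x • (parabolic I : Set W), I, hI, x, rfl⟩

/-- The two types of relations that generate the facial weak order. -/
inductive FacialCover [Finite W] : CoxeterComplex cs → CoxeterComplex cs → Prop
  /-- `x W_I ⋖ x W_{I ∪ {s}}` if `s ∉ I` and `x ∈ W^{I ∪ {s}}`. -/
  | up (x s : W) (I : Set W) (hI : I ⊆ simples cs) (hs : s ∈ simples cs) (hsI : s ∉ I)
      (hx : x ∈ minReps cs (insert s I)) :
      FacialCover (coset cs x I hI) (coset cs x (insert s I) (Set.insert_subset hs hI))
  /-- `x W_I ⋖ x w_I w_{I ∖ {s}} W_{I ∖ {s}}` if `s ∈ I` and `x ∈ W^I`, where `w_K` is the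
  longest element of `W_K`. -/
  | down (x s : W) (I : Set W) (hI : I ⊆ simples cs) (hsI : s ∈ I)
      (hx : x ∈ minReps cs I) :
      FacialCover (coset cs x I hI)
        (coset cs (x * longest cs I * longest cs (I \ {s})) (I \ {s})
          (Set.sdiff_subset.trans hI))

/-! ### The facial weak order is antisymmetric

The facts up to `facialCover_lt` serve only to show that the reflexive transitive closure of
`FacialCover` is a partial order. -/

section Exchange

open Classical in
/-- The action of a simple reflection on `W × ℤ/2`, which counts inversions modulo 2. -/
def signAct (i : B) : Function.End (W × ZMod 2) := fun q =>
  (cs.simple i * q.1 * cs.simple i, q.2 + if q.1 = cs.simple i then 1 else 0)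

open Classical in
theorem signAct_pow (i j : B) (m : ℕ) (t : W) (e : ZMod 2) :
    ((signAct cs i * signAct cs j) ^ m) (t, e) =
      ((cs.simple i * cs.simple j) ^ m * t * ((cs.simple i * cs.simple j) ^ m)⁻¹,
        e + ∑ n ∈ Finset.range (2 * m),
          if t = ((cs.simple i * cs.simple j) ^ n)⁻¹ * cs.simple j then 1 else 0) := by
  set p := cs.simple i * cs.simple j with hp
  have hpj : ∀ n : ℕ, cs.simple j * p ^ n = (p ^ n)⁻¹ * cs.simple j := by
    intro n
    have h1 : cs.simple j * p * (cs.simple j)⁻¹ = p⁻¹ := by simp [hp, mul_assoc]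
    have h2 : cs.simple j * p ^ n * (cs.simple j)⁻¹ = (p ^ n)⁻¹ := by
      rw [← conj_pow, h1, inv_pow]
    rw [← h2]; group
  induction m with
  | zero =>
    simp only [pow_zero, one_mul, inv_one, mul_one, mul_zero, Finset.range_zero,
      Finset.sum_empty, add_zero]
    rfl
  | succ m ih =>
    have e1 : (p ^ m * t * (p ^ m)⁻¹ = cs.simple j) ↔ (t = (p ^ (2 * m))⁻¹ * cs.simple j) := by
      rw [mul_inv_eq_iff_eq_mul, hpj, ← eq_inv_mul_iff_mul_eq, two_mul, pow_add]
      simp [mul_assoc]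
    have e2 : (cs.simple j * (p ^ m * t * (p ^ m)⁻¹) * cs.simple j = cs.simple i) ↔
        (t = (p ^ (2 * m + 1))⁻¹ * cs.simple j) := by
      have : (cs.simple j * (p ^ m * t * (p ^ m)⁻¹) * cs.simple j = cs.simple i) ↔
          (p ^ m * t * (p ^ m)⁻¹ = p⁻¹ * cs.simple j) := by
        constructor
        · intro h
          have : p ^ m * t * (p ^ m)⁻¹ = cs.simple j *
            (cs.simple j * (p ^ m * t * (p ^ m)⁻¹) * cs.simple j) * cs.simple j := by
            simp [mul_assoc]
          rw [this, h]; simp [hp, mul_assoc]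
        · intro h
          rw [h]; simp [hp, mul_assoc]
      rw [this, mul_inv_eq_iff_eq_mul, mul_assoc, hpj, ← eq_inv_mul_iff_mul_eq,
        show 2 * m + 1 = m + 1 + m by ring, pow_add, pow_succ']
      simp only [mul_inv_rev, mul_assoc]
      have hc : (p ^ m)⁻¹ * p⁻¹ = p⁻¹ * (p ^ m)⁻¹ := by
        rw [← mul_inv_rev, ← mul_inv_rev, ← pow_succ, ← pow_succ']
      have hc' : ∀ z, (p ^ m)⁻¹ * (p⁻¹ * z) = p⁻¹ * ((p ^ m)⁻¹ * z) := by
        intro z; rw [← mul_assoc, hc, mul_assoc]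
      simp only [hc']
    rw [pow_succ' (signAct cs i * signAct cs j)]
    change signAct cs i (signAct cs j (((signAct cs i * signAct cs j) ^ m) (t, e))) = _
    rw [ih, show 2 * (m + 1) = 2 * m + 1 + 1 by ring, Finset.sum_range_succ,
      Finset.sum_range_succ]
    simp only [signAct, e1, e2]
    refine Prod.ext ?_ ?_
    · simp only [pow_succ' p m]
      generalize p ^ m = q
      simp [hp, mul_assoc]
    · simp [add_assoc]

theorem signAct_liftable : M.IsLiftable (signAct cs) := by
  classical
  intro i j
  funext ⟨t, e⟩
  have hp : (cs.simple i * cs.simple j) ^ M i j = 1 := cs.simple_mul_simple_pow i j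
  rw [signAct_pow, two_mul, Finset.sum_range_add, hp]
  simp only [pow_add, hp, one_mul]
  simp only [CharTwo.add_self_eq_zero, inv_one, mul_one, add_zero]
  rfl

open Classical in
theorem signAct_word (ω : List B) (t : W) (e : ZMod 2) :
    (cs.lift ⟨signAct cs, signAct_liftable cs⟩ (cs.wordProd ω)) (t, e) =
      (cs.wordProd ω * t * (cs.wordProd ω)⁻¹, e + ((cs.rightInvSeq ω).count t : ZMod 2)) := by
  induction ω with
  | nil =>
    rw [cs.wordProd_nil, map_one]
    simp only [CoxeterSystem.rightInvSeq_nil, List.count_nil, Nat.cast_zero, one_mul, inv_one,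
      mul_one, add_zero]
    rfl
  | cons i ω ih =>
    rw [cs.wordProd_cons, map_mul, cs.lift_apply_simple]
    change signAct cs i ((cs.lift ⟨signAct cs, signAct_liftable cs⟩ (cs.wordProd ω)) (t, e)) = _
    rw [ih, CoxeterSystem.rightInvSeq, List.count_cons]
    refine Prod.ext ?_ ?_
    · simp [signAct, mul_assoc]
    · have : (cs.wordProd ω * t * (cs.wordProd ω)⁻¹ = cs.simple i) ↔
          ((cs.wordProd ω)⁻¹ * cs.simple i * cs.wordProd ω = t) := by
        rw [mul_inv_eq_iff_eq_mul, mul_assoc, inv_mul_eq_iff_eq_mul, eq_comm]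
      simp only [signAct, this, beq_iff_eq]
      split_ifs <;> simp [add_assoc]

/-- The exchange property. -/
theorem exchange (ω : List B) (i : B)
    (h : cs.length (cs.wordProd ω * cs.simple i) < cs.length (cs.wordProd ω)) :
    ∃ k < ω.length, cs.wordProd ω * cs.simple i = cs.wordProd (ω.eraseIdx k) := by
  classical
  obtain ⟨ρ, hρ, hρw⟩ := cs.exists_isReduced (cs.wordProd ω * cs.simple i)
  have hw : cs.wordProd ω = cs.wordProd (ρ.concat i) := by
    rw [cs.wordProd_concat, ← hρw]; simp
  have hred : cs.IsReduced (ρ.concat i) := by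
    have h1 := cs.length_mul_simple (cs.wordProd ω) i
    unfold CoxeterSystem.IsReduced at hρ ⊢
    rw [← hw, List.length_concat, ← hρ, ← hρw]
    omega
  have hmem : cs.simple i ∈ cs.rightInvSeq (ρ.concat i) := by
    rw [cs.rightInvSeq_concat]; simp
  have hc1 : (cs.rightInvSeq (ρ.concat i)).count (cs.simple i) = 1 :=
    List.count_eq_one_of_mem hred.nodup_rightInvSeq hmem
  have h1 := signAct_word cs ω (cs.simple i) 0
  have h2 := signAct_word cs (ρ.concat i) (cs.simple i) 0
  rw [← hw, h1, hc1] at h2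
  have h3 := congrArg Prod.snd h2
  have hm : cs.simple i ∈ cs.rightInvSeq ω := by
    by_contra hn
    rw [List.count_eq_zero_of_not_mem hn] at h3
    simp at h3
  obtain ⟨k, hk, hki⟩ := List.mem_iff_getElem.mp hm
  refine ⟨k, by simpa using hk, ?_⟩
  rw [← cs.wordProd_mul_getD_rightInvSeq, List.getD_eq_getElem _ 1 hk, hki]

end Exchange

/-- Every element of `W_I` is the product of a word in `I`. -/
theorem exists_word {I : Set W} (hI : I ⊆ simples cs) {v : W} (hv : v ∈ parabolic I) :
    ∃ ω : List B, (∀ i ∈ ω, cs.simple i ∈ I) ∧ cs.wordProd ω = v := by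
  induction hv using Subgroup.closure_induction with
  | mem x hx =>
    obtain ⟨i, rfl⟩ := hI hx
    exact ⟨[i], by simpa using hx, by simp⟩
  | one => exact ⟨[], by simp, by simp⟩
  | mul x y _ _ hx hy =>
    obtain ⟨ω, h1, rfl⟩ := hx
    obtain ⟨ρ, h2, rfl⟩ := hy
    refine ⟨ω ++ ρ, ?_, cs.wordProd_append _ _⟩
    intro i hi
    rcases List.mem_append.1 hi with h | h
    exacts [h1 i h, h2 i h]
  | inv x _ hx =>
    obtain ⟨ω, h1, rfl⟩ := hx
    exact ⟨ω.reverse, by simpa using h1, cs.wordProd_reverse ω⟩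

theorem wordProd_mem {I : Set W} (ω : List B) (h : ∀ i ∈ ω, cs.simple i ∈ I) :
    cs.wordProd ω ∈ parabolic I := by
  apply Subgroup.list_prod_mem
  intro x hx
  obtain ⟨i, hi, rfl⟩ := List.mem_map.1 hx
  exact Subgroup.subset_closure (h i hi)

/-- Lengths add along a coset with shortest element `u`, for words in `I` that are shortest among
the words in `I` with the same product. -/
theorem length_mul_word {I : Set W} {u : W}
    (hu : ∀ v ∈ parabolic I, cs.length u ≤ cs.length (u * v)) (ω : List B)
    (hω : ∀ i ∈ ω, cs.simple i ∈ I)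
    (hmin : ∀ ρ : List B, (∀ i ∈ ρ, cs.simple i ∈ I) → cs.wordProd ρ = cs.wordProd ω →
      ω.length ≤ ρ.length) :
    cs.length (u * cs.wordProd ω) = cs.length u + ω.length := by
  induction ω using List.reverseRecOn with
  | nil => simp
  | append_singleton ω i ih =>
    have hω' : ∀ j ∈ ω, cs.simple j ∈ I := fun j hj => hω j (by simp [hj])
    have hi : cs.simple i ∈ I := hω i (by simp)
    have ih' := ih hω' (by
      intro ρ h1 h2
      have := hmin (ρ ++ [i]) (by
        intro j hj
        rcases List.mem_append.1 hj with h | h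
        · exact h1 j h
        · rw [List.mem_singleton.1 h]; exact hi)
        (by rw [cs.wordProd_append, cs.wordProd_append, h2])
      simpa using this)
    rw [cs.wordProd_append, cs.wordProd_singleton, ← mul_assoc]
    rcases cs.length_mul_simple (u * cs.wordProd ω) i with h | h
    · rw [h, ih', List.length_append]; simp [add_assoc]
    exfalso
    obtain ⟨ρ, hρ, hρu⟩ := cs.exists_isReduced u
    have hprod : u * cs.wordProd ω = cs.wordProd (ρ ++ ω) := by rw [cs.wordProd_append, ← hρu]
    obtain ⟨k, hk, hke⟩ := exchange cs (ρ ++ ω) i (by rw [← hprod]; omega)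
    rw [← hprod] at hke
    rcases lt_or_ge k ρ.length with hlt | hge
    · rw [List.eraseIdx_append_of_lt_length hlt, cs.wordProd_append] at hke
      have h1 : u * (cs.wordProd ω * cs.simple i * (cs.wordProd ω)⁻¹) =
          cs.wordProd (ρ.eraseIdx k) := by
        rw [← mul_assoc, ← mul_assoc, hke]; simp
      have hm := wordProd_mem cs ω hω'
      have h2 := hu _ (mul_mem (mul_mem hm (Subgroup.subset_closure hi)) (inv_mem hm))
      rw [h1] at h2
      have h3 := cs.length_wordProd_le (ρ.eraseIdx k)
      have h4 := List.length_eraseIdx_add_one hlt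
      have h5 : cs.length u = ρ.length := by
        conv_lhs => rw [hρu]
        exact hρ
      omega
    · rw [List.eraseIdx_append_of_length_le hge, cs.wordProd_append, ← hρu, mul_assoc] at hke
      have h1 := mul_left_cancel hke
      have h2 := hmin (ω.eraseIdx (k - ρ.length))
        (fun j hj => hω' j (List.mem_of_mem_eraseIdx hj))
        (by rw [← h1, cs.wordProd_append, cs.wordProd_singleton])
      have h3 : (ω.eraseIdx (k - ρ.length)).length ≤ ω.length := List.length_eraseIdx_le _ _
      simp at h2
      omega

/-- A shortest word in `I` for an element of `W_I`. -/
theorem exists_min_word {I : Set W} (hI : I ⊆ simples cs) {v : W} (hv : v ∈ parabolic I) :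
    ∃ ω : List B, (∀ i ∈ ω, cs.simple i ∈ I) ∧ cs.wordProd ω = v ∧
      ∀ ρ : List B, (∀ i ∈ ρ, cs.simple i ∈ I) → cs.wordProd ρ = cs.wordProd ω →
        ω.length ≤ ρ.length := by
  classical
  have hex : ∃ n, ∃ ω : List B, (∀ i ∈ ω, cs.simple i ∈ I) ∧ cs.wordProd ω = v ∧
      ω.length = n := by
    obtain ⟨ω, h1, h2⟩ := exists_word cs hI hv
    exact ⟨_, ω, h1, h2, rfl⟩
  obtain ⟨ω, h1, h2, h3⟩ := Nat.find_spec hex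
  refine ⟨ω, h1, h2, fun ρ h4 h5 => ?_⟩
  rw [h3]
  exact Nat.find_min' hex ⟨ρ, h4, h5.trans h2, rfl⟩

/-- An element of `W^I` is the unique shortest element of its coset. -/
theorem length_lt_of_minReps {I : Set W} (hI : I ⊆ simples cs) {x : W} (hx : x ∈ minReps cs I)
    {v : W} (hv : v ∈ parabolic I) (hv1 : v ≠ 1) : cs.length x < cs.length (x * v) := by
  have hex : ∃ u, ∃ v ∈ parabolic I, u = x * v ∧
      ∀ v' ∈ parabolic I, cs.length u ≤ cs.length (u * v') := by
    classical
    have hne : ∃ n, ∃ v ∈ parabolic I, cs.length (x * v) = n := ⟨_, 1, one_mem _, rfl⟩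
    obtain ⟨v, hv, h⟩ := Nat.find_spec hne
    refine ⟨x * v, v, hv, rfl, fun v' hv' => ?_⟩
    rw [h]
    exact Nat.find_min' hne ⟨v * v', mul_mem hv hv', by rw [mul_assoc]⟩
  obtain ⟨u, z, hz, huz, hu⟩ := hex
  have hxu : x = u := by
    obtain ⟨ω, h1, h2, h3⟩ := exists_min_word cs hI (inv_mem hz)
    have hxw : x = u * cs.wordProd ω := by rw [h2, huz]; simp
    rcases List.eq_nil_or_concat ω with rfl | ⟨ρ, i, rfl⟩
    · simpa using hxw
    exfalso
    rw [List.concat_eq_append] at *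
    have hl := length_mul_word cs hu _ h1 h3
    have hxi := hx (cs.simple i) (h1 i (by simp))
    rw [← hxw] at hl
    have h4 : x * cs.simple i = u * cs.wordProd ρ := by
      rw [hxw, cs.wordProd_append]; simp [mul_assoc]
    have h5 := cs.length_mul_le u (cs.wordProd ρ)
    have h6 := cs.length_wordProd_le ρ
    rw [h4] at hxi
    simp at hl
    omega
  subst hxu
  obtain ⟨ω, h1, h2, h3⟩ := exists_min_word cs hI hv
  have hl := length_mul_word cs hu _ h1 h3
  rw [h2] at hl
  have : ω.length ≠ 0 := by
    intro h0
    rw [List.length_eq_zero_iff] at h0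
    subst h0
    exact hv1 (by simpa using h2.symm)
  omega

/-- The smallest length of an element of a set. -/
def minLength (A : Set W) : ℕ := sInf (cs.length '' A)

theorem minLength_coset {I : Set W} (hI : I ⊆ simples cs) {x : W} (hx : x ∈ minReps cs I) :
    minLength cs (x • (parabolic I : Set W)) = cs.length x := by
  apply le_antisymm
  · exact Nat.sInf_le ⟨x, ⟨1, one_mem _, by simp⟩, rfl⟩
  · refine le_csInf ⟨_, x, ⟨1, one_mem _, by simp⟩, rfl⟩ ?_
    rintro _ ⟨_, ⟨v, hv, rfl⟩, rfl⟩
    by_cases h : v = 1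
    · simp [h]
    · exact (length_lt_of_minReps cs hI hx hv h).le

/-- A relation of the facial weak order strictly raises the pair formed by the smallest length and
the cardinality, in lexicographic order, unless it is an equality. -/
theorem facialCover_lt [Finite W] {F G : CoxeterComplex cs} (h : FacialCover cs F G) :
    F = G ∨ toLex (minLength cs F.1, F.1.ncard) < toLex (minLength cs G.1, G.1.ncard) := by
  induction h with
  | up x s I hI hs hsI hx =>
    have hx' : x ∈ minReps cs I := fun t ht => hx t (Set.mem_insert_of_mem _ ht)
    have hsub : x • (parabolic I : Set W) ⊆ x • (parabolic (insert s I) : Set W) :=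
      Set.smul_set_mono (Subgroup.closure_mono (Set.subset_insert _ _))
    rcases hsub.eq_or_ssubset with heq | hss
    · exact Or.inl (Subtype.ext heq)
    · right
      rw [Prod.Lex.toLex_lt_toLex]
      right
      refine ⟨?_, Set.ncard_lt_ncard hss⟩
      exact (minLength_coset cs hI hx').trans
        (minLength_coset cs (Set.insert_subset hs hI) hx).symm
  | down x s I hI hsI hx =>
    have hK : I \ {s} ⊆ simples cs := Set.sdiff_subset.trans hI
    have hle : parabolic (I \ {s}) ≤ parabolic I := Subgroup.closure_mono Set.sdiff_subset
    have hwK := longest_mem cs (I \ {s})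
    have hwI := longest_mem cs I
    by_cases hmem : longest cs I ∈ parabolic (I \ {s})
    · left
      obtain ⟨i, rfl⟩ := hI hsI
      obtain ⟨ω, h1, h2⟩ := exists_word cs hK hmem
      have hlt : cs.length (longest cs I * cs.simple i) < cs.length (longest cs I) :=
        lt_of_le_of_ne
          (length_le_longest cs I (mul_mem hwI (Subgroup.subset_closure hsI)))
          (cs.length_mul_simple_ne _ i)
      rw [← h2] at hlt
      obtain ⟨k, hk, hke⟩ := exchange cs ω i hlt
      have h3 : cs.simple i ∈ parabolic (I \ {cs.simple i}) := by
        rw [h2] at hke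
        have h4 : longest cs I * cs.simple i ∈ parabolic (I \ {cs.simple i}) := by
          rw [hke]
          exact wordProd_mem cs _ fun j hj => h1 j (List.mem_of_mem_eraseIdx hj)
        exact (Subgroup.mul_mem_cancel_left _ hmem).1 h4
      have h5 : parabolic I = parabolic (I \ {cs.simple i}) := by
        refine le_antisymm ((Subgroup.closure_le _).2 fun t ht => ?_) hle
        by_cases hti : t = cs.simple i
        · rw [hti]; exact h3
        · exact Subgroup.subset_closure ⟨ht, hti⟩
      apply Subtype.ext
      change x • (parabolic I : Set W) =
        (x * longest cs I * longest cs (I \ {cs.simple i})) •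
          (parabolic (I \ {cs.simple i}) : Set W)
      rw [← h5, mul_assoc, mul_smul]
      congr 1
      exact (smul_coe_set (mul_mem hwI (hle hwK))).symm
    · right
      rw [Prod.Lex.toLex_lt_toLex]
      left
      have h1 : minLength cs (coset cs x I hI).1 = cs.length x := minLength_coset cs hI hx
      rw [h1]
      change cs.length x < minLength cs
        ((x * longest cs I * longest cs (I \ {s})) • (parabolic (I \ {s}) : Set W))
      refine Nat.lt_of_succ_le (le_csInf ⟨_, _, ⟨1, one_mem _, rfl⟩, rfl⟩ ?_)
      rintro _ ⟨_, ⟨v, hv, rfl⟩, rfl⟩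
      apply Nat.succ_le_of_lt
      simp only [smul_eq_mul, mul_assoc]
      refine length_lt_of_minReps cs hI hx
        (mul_mem hwI (mul_mem (hle hwK) (hle hv))) fun h0 => hmem ?_
      have : longest cs I = (longest cs (I \ {s}) * v)⁻¹ := eq_inv_of_mul_eq_one_left h0
      rw [this]
      exact inv_mem (mul_mem hwK hv)

/-- The facial weak order on the Coxeter complex: the reflexive transitive closure of
`FacialCover`. -/
instance [Finite W] : PartialOrder (CoxeterComplex cs) where
  le := Relation.ReflTransGen (FacialCover cs)
  le_refl _ := Relation.ReflTransGen.refl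
  le_trans _ _ _ := Relation.ReflTransGen.trans
  le_antisymm := by
    have key : ∀ F G : CoxeterComplex cs, Relation.ReflTransGen (FacialCover cs) F G →
        F = G ∨ toLex (minLength cs F.1, F.1.ncard) < toLex (minLength cs G.1, G.1.ncard) := by
      intro F G h
      induction h with
      | refl => exact Or.inl rfl
      | tail _ h2 ih =>
        rcases ih with rfl | ih
        · exact facialCover_lt cs h2
        · rcases facialCover_lt cs h2 with rfl | h3
          · exact Or.inr ih
          · exact Or.inr (ih.trans h3)
    intro F G h1 h2
    rcases key F G h1 with h | h
    · exact h
    · rcases key G F h2 with h' | h'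
      · exact h'.symm
      · exact absurd h' h.asymm

instance [Finite W] : Finite (CoxeterComplex cs) := Subtype.finite

instance [Finite W] : LocallyFiniteOrder (CoxeterComplex cs) := by
  classical
  haveI := Fintype.ofFinite (CoxeterComplex cs)
  exact Fintype.toLocallyFiniteOrder

instance : DecidableEq (CoxeterComplex cs) := Classical.decEq _

/-- The Möbius function of the facial weak order. -/
def facialMu [Finite W] (F G : CoxeterComplex cs) : ℤ := IncidenceAlgebra.mu ℤ F G

end FacialWeak

end

namespace FacialWeak

variable {B W : Type*} [Group W] {M : CoxeterMatrix B} (cs : CoxeterSystem M W)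

/-! ### The strong exchange property -/

/-! The Möbius function `μ(e, ·)` is the only function whose sum over the interval from the bottom
to `F` is 1 if `F` is the bottom and 0 otherwise. So it suffices to check these sums for the
function that is `(-1)^|J|` on the cosets `W_J` and 0 elsewhere, and for this one must know which
`W_J` lie below `F`.

Let `D(F)` be the set of simple left descents of the longest element of `F`. The key fact,
`parabolic_le_iff`, is that `W_J ≤ F` if and only if `J ⊆ D(F)`. The sum then runs over the subsets
of `D(F)` with alternating signs. It vanishes unless `D(F)` is empty, and by
`eq_bot_of_leftDescents_eq_empty` that happens only at the bottom.

One direction of the key fact holds because `D` is monotone (`leftDescents_mono`) and `D(W_J) = J`.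
The other, `parabolic_le_coset`, goes down from `yW_K` by generating relations that keep `J` inside
`D`, until `W_J` is reached. The theory of minimal representatives and longest elements that this
needs rests on the exchange properties. -/

/-- The number of times that `t` occurs in the inversion sequence of a word for `w`, modulo 2. -/
noncomputable def invParity (w t : W) : ZMod 2 :=
  (cs.lift ⟨signAct cs, signAct_liftable cs⟩ w (t, 0)).2

open Classical in
theorem invParity_wordProd (ω : List B) (t : W) :
    invParity cs (cs.wordProd ω) t = ((cs.rightInvSeq ω).count t : ZMod 2) := by
  rw [invParity, signAct_word, zero_add]

theorem lift_signAct_apply (w t : W) (e : ZMod 2) :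
    cs.lift ⟨signAct cs, signAct_liftable cs⟩ w (t, e) =
      (w * t * w⁻¹, e + invParity cs w t) := by
  obtain ⟨ω, rfl⟩ := cs.wordProd_surjective w
  rw [signAct_word, invParity_wordProd]

theorem invParity_mul (v w t : W) :
    invParity cs (v * w) t = invParity cs w t + invParity cs v (w * t * w⁻¹) := by
  rw [invParity, map_mul]
  change (cs.lift ⟨signAct cs, signAct_liftable cs⟩ v
    (cs.lift ⟨signAct cs, signAct_liftable cs⟩ w (t, 0))).2 = _
  rw [lift_signAct_apply, lift_signAct_apply, zero_add]

theorem invParity_one (t : W) : invParity cs 1 t = 0 := by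
  classical
  rw [← cs.wordProd_nil, invParity_wordProd]
  simp

theorem invParity_simple_self (i : B) : invParity cs (cs.simple i) (cs.simple i) = 1 := by
  classical
  rw [← cs.wordProd_singleton, invParity_wordProd]
  simp

/-- Write `t = v s v⁻¹`. By the cocycle identity for `v v⁻¹ = 1` the contributions of `v` and `v⁻¹`
cancel, and only that of `s` remains. -/
theorem invParity_self {t : W} (ht : cs.IsReflection t) : invParity cs t t = 1 := by
  obtain ⟨v, i, rfl⟩ := ht
  have h1 := invParity_mul cs v v⁻¹ (v * cs.simple i * v⁻¹)
  have h2 : v⁻¹ * (v * cs.simple i * v⁻¹) * v⁻¹⁻¹ = cs.simple i := by group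
  rw [mul_inv_cancel, invParity_one, h2] at h1
  rw [invParity_mul, h2, invParity_mul, invParity_simple_self, mul_inv_cancel_right,
    add_left_comm, ← h1, add_zero]

/-- The parity does not depend on the word, so `t` already occurs in the inversion sequence of a
reduced word for `w`. -/
theorem length_mul_lt_of_invParity {w t : W} (h : invParity cs w t ≠ 0) :
    cs.length (w * t) < cs.length w := by
  classical
  obtain ⟨ω, hω, rfl⟩ := cs.exists_isReduced w
  rw [invParity_wordProd] at h
  have hm : t ∈ cs.rightInvSeq ω := by
    by_contra hn
    rw [List.count_eq_zero_of_not_mem hn] at h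
    simp at h
  exact (cs.isRightInversion_of_mem_rightInvSeq hω hm).2

/-- The strong exchange property. -/
theorem strong_exchange (ω : List B) {t : W} (ht : cs.IsReflection t)
    (h : cs.length (cs.wordProd ω * t) < cs.length (cs.wordProd ω)) :
    ∃ k < ω.length, cs.wordProd ω * t = cs.wordProd (ω.eraseIdx k) := by
  classical
  -- If the parity of `w` at `t` were 0, that of `w t` would be 1, and then `w = (w t) t` would be
  -- shorter than `w t`.
  have hw : invParity cs (cs.wordProd ω) t ≠ 0 := by
    intro h0
    have h1 := invParity_mul cs (cs.wordProd ω * t) t t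
    rw [mul_assoc, ht.mul_self, mul_one, h0, invParity_self cs ht, one_mul, ht.inv] at h1
    have h2 : invParity cs (cs.wordProd ω * t) t ≠ 0 := by
      intro h3
      rw [h3] at h1
      simp at h1
    have h3 := length_mul_lt_of_invParity cs h2
    rw [mul_assoc, ht.mul_self, mul_one] at h3
    exact h.asymm h3
  have hm : t ∈ cs.rightInvSeq ω := by
    by_contra hn
    rw [invParity_wordProd, List.count_eq_zero_of_not_mem hn] at hw
    simp at hw
  obtain ⟨k, hk, hki⟩ := List.mem_iff_getElem.mp hm
  refine ⟨k, by simpa using hk, ?_⟩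
  rw [← cs.wordProd_mul_getD_rightInvSeq, List.getD_eq_getElem _ 1 hk, hki]

/-! ### Minimal coset representatives -/

variable {cs}

theorem length_mul_of_mem_simples {s : W} (hs : s ∈ simples cs) (w : W) :
    cs.length (w * s) = cs.length w + 1 ∨ cs.length (w * s) + 1 = cs.length w := by
  obtain ⟨i, rfl⟩ := hs
  exact cs.length_mul_simple w i

theorem length_mul_of_mem_simples' {s : W} (hs : s ∈ simples cs) (w : W) :
    cs.length (s * w) = cs.length w + 1 ∨ cs.length (s * w) + 1 = cs.length w := by
  obtain ⟨i, rfl⟩ := hs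
  exact cs.length_simple_mul w i

theorem one_mem_minReps {I : Set W} (hI : I ⊆ simples cs) : (1 : W) ∈ minReps cs I := by
  intro s hs
  obtain ⟨i, rfl⟩ := hI hs
  simp

theorem minReps_anti {I K : Set W} (h : I ⊆ K) : minReps cs K ⊆ minReps cs I :=
  fun _ hx s hs => hx s (h hs)

/-- Lengths add in `W^I W_I`. -/
theorem length_mul_of_minReps {I : Set W} (hI : I ⊆ simples cs) {x u : W}
    (hx : x ∈ minReps cs I) (hu : u ∈ parabolic I) :
    cs.length (x * u) = cs.length x + cs.length u := by
  have hle : ∀ {x : W}, x ∈ minReps cs I → ∀ v ∈ parabolic I,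
      cs.length x ≤ cs.length (x * v) := by
    intro x hx v hv
    by_cases h : v = 1
    · simp [h]
    · exact (length_lt_of_minReps cs hI hx hv h).le
  obtain ⟨ω, h1, rfl, h3⟩ := exists_min_word cs hI hu
  have h4 := length_mul_word cs (hle (one_mem_minReps hI)) ω h1 h3
  rw [length_mul_word cs (hle hx) ω h1 h3]
  simp at h4
  omega

/-- An element of `W_I` is the product of a reduced word in `I`. -/
theorem exists_reduced_word {I : Set W} (hI : I ⊆ simples cs) {u : W} (hu : u ∈ parabolic I) :
    ∃ ω : List B, (∀ i ∈ ω, cs.simple i ∈ I) ∧ cs.wordProd ω = u ∧ ω.length = cs.length u := by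
  obtain ⟨ω, h1, rfl, h3⟩ := exists_min_word cs hI hu
  refine ⟨ω, h1, rfl, ?_⟩
  have h4 := length_mul_word cs (u := 1) (by simp) ω h1 h3
  simp at h4
  exact h4.symm

theorem eq_one_of_mem_minReps {I : Set W} (hI : I ⊆ simples cs) {x : W}
    (hx : x ∈ minReps cs I) (hxI : x ∈ parabolic I) : x = 1 := by
  by_contra h
  have := length_lt_of_minReps cs hI hx (inv_mem hxI) (inv_ne_one.2 h)
  simp at this

/-- Every coset of `W_I` has a representative in `W^I`. -/
theorem exists_mul_minReps {I : Set W} (hI : I ⊆ simples cs) (w : W) :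
    ∃ x ∈ minReps cs I, ∃ u ∈ parabolic I, w = x * u := by
  classical
  have hne : ∃ n, ∃ u ∈ parabolic I, cs.length (w * u) = n := ⟨_, 1, one_mem _, rfl⟩
  obtain ⟨u, hu, h⟩ := Nat.find_spec hne
  refine ⟨w * u, fun s hs => ?_, u⁻¹, inv_mem hu, by simp⟩
  have h1 : cs.length (w * u) ≤ cs.length (w * u * s) := by
    rw [h]
    exact Nat.find_min' hne ⟨u * s, mul_mem hu (Subgroup.subset_closure hs), by rw [mul_assoc]⟩
  rcases length_mul_of_mem_simples (hI hs) (w * u) with h2 | h2 <;> omega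

/-- Deodhar's lemma. -/
theorem simple_mul_mem_minReps {I : Set W} (hI : I ⊆ simples cs) {x j : W}
    (hx : x ∈ minReps cs I) (hj : j ∈ simples cs) (hjx : cs.length x < cs.length (j * x)) :
    j * x ∈ minReps cs I ∨ ∃ k ∈ I, j * x = x * k := by
  by_contra! hcon
  obtain ⟨h1, h2⟩ := hcon
  simp only [minReps, Set.mem_ofPred_eq, not_forall, not_lt] at h1
  obtain ⟨k, hk, hle⟩ := h1
  have hlk := hx k hk
  refine h2 k hk ?_
  obtain ⟨i, rfl⟩ := hI hk
  obtain ⟨j, rfl⟩ := hj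
  obtain ⟨ω, hω, rfl⟩ := cs.exists_isReduced x
  have hlt : cs.length (cs.wordProd (j :: ω) * cs.simple i) < cs.length (cs.wordProd (j :: ω)) := by
    rw [cs.wordProd_cons]
    exact lt_of_le_of_ne hle (cs.length_mul_simple_ne _ i)
  obtain ⟨n, hn, he⟩ := exchange cs (j :: ω) i hlt
  rw [cs.wordProd_cons] at he
  -- Deleting the new first letter gives `j x = x k`. Deleting any other letter makes `x k` no
  -- longer than `x`, against `x ∈ W^I`.
  cases n with
  | zero =>
    rw [List.eraseIdx_cons_zero] at he
    calc cs.simple j * cs.wordProd ω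
        = cs.simple j * cs.wordProd ω * cs.simple i * cs.simple i := by simp
      _ = _ := by rw [he]
  | succ n =>
    exfalso
    rw [List.eraseIdx_cons_succ, cs.wordProd_cons, mul_assoc] at he
    have h3 := mul_left_cancel he
    have h4 := cs.length_wordProd_le (ω.eraseIdx n)
    have h5 := List.length_eraseIdx_le ω n
    have h6 := hω.eq
    rw [h3] at hlk
    omega

/-! ### The longest element of a parabolic subgroup -/

variable (cs) in
/-- Lengths subtract from that of an element of maximal length of `W_I`. -/
theorem length_longest_mul {I : Set W} (hI : I ⊆ simples cs) {w : W} (hw : w ∈ parabolic I)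
    (hmax : ∀ v ∈ parabolic I, cs.length v ≤ cs.length w) {u : W} (hu : u ∈ parabolic I) :
    cs.length (w * u) + cs.length u = cs.length w := by
  obtain ⟨ω, h1, rfl, h3⟩ := exists_reduced_word hI hu
  clear hu
  induction ω using List.reverseRecOn with
  | nil => simp
  | append_singleton ω i ih =>
    have hω : ∀ j ∈ ω, cs.simple j ∈ I := fun j hj => h1 j (by simp [hj])
    have hi : cs.simple i ∈ I := h1 i (by simp)
    have hp : cs.wordProd (ω ++ [i]) = cs.wordProd ω * cs.simple i := by
      rw [cs.wordProd_append, cs.wordProd_singleton]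
    have hl : ω.length = cs.length (cs.wordProd ω) := by
      have h4 := cs.length_wordProd_le ω
      rcases cs.length_mul_simple (cs.wordProd ω) i with h | h <;>
        rw [hp, List.length_append, List.length_singleton] at h3 <;> omega
    have ih' := ih hω hl
    rw [hp] at h3 ⊢
    rw [List.length_append, List.length_singleton] at h3
    rw [← mul_assoc]
    set u := cs.wordProd ω with hu
    rcases cs.length_mul_simple (w * u) i with h | h
    swap
    · omega
    exfalso
    have hum : u ∈ parabolic I := wordProd_mem cs ω hω
    -- If `s` lengthens `w u`, apply strong exchange to the reflection `t = u s u⁻¹`, which shortens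
    -- `w` by maximality, and to a reduced word of `w u` followed by one of `u⁻¹`. A deletion in the
    -- first part makes `w u s` shorter than `w u`; one in the second makes `u s` shorter than `u`.
    have ht : cs.IsReflection (u * cs.simple i * u⁻¹) := ⟨u, i, rfl⟩
    obtain ⟨ρ, hρ, hρw⟩ := cs.exists_isReduced (w * u)
    have hw' : w = cs.wordProd (ρ ++ ω.reverse) := by
      rw [cs.wordProd_append, ← hρw, cs.wordProd_reverse, ← hu]; simp
    have hlt : cs.length (w * (u * cs.simple i * u⁻¹)) < cs.length w :=
      lt_of_le_of_ne (hmax _ (mul_mem hw (mul_mem (mul_mem hum (Subgroup.subset_closure hi))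
        (inv_mem hum)))) (ht.length_mul_left_ne w)
    obtain ⟨k, hk, he⟩ := strong_exchange cs (ρ ++ ω.reverse) ht (by rwa [← hw'])
    rw [← hw'] at he
    rcases lt_or_ge k ρ.length with hkl | hkl
    · rw [List.eraseIdx_append_of_lt_length hkl, cs.wordProd_append, cs.wordProd_reverse, ← hu,
        ← mul_assoc] at he
      have h5 := mul_right_cancel he
      rw [← mul_assoc] at h5
      have h6 := cs.length_wordProd_le (ρ.eraseIdx k)
      have h7 := List.length_eraseIdx_le ρ k
      have h8 := hρ.eq
      rw [← hρw] at h8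
      rw [← h5] at h6
      omega
    · rw [List.eraseIdx_append_of_length_le hkl, cs.wordProd_append, ← hρw, mul_assoc w u] at he
      have h5 := mul_left_cancel he
      rw [mul_assoc] at h5
      have h6 := mul_left_cancel h5
      have h7 := cs.length_wordProd_le (ω.reverse.eraseIdx (k - ρ.length))
      have h8 := List.length_eraseIdx_le ω.reverse (k - ρ.length)
      have h9 : cs.length (cs.simple i * u⁻¹) = cs.length (u * cs.simple i) := by
        rw [← cs.length_inv, mul_inv_rev, inv_inv, cs.inv_simple]
      rw [← h6, h9] at h7
      simp at h8
      omega

section Finite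

variable [Finite W]

theorem eq_longest {I : Set W} (hI : I ⊆ simples cs) {w : W} (hw : w ∈ parabolic I)
    (h : cs.length (longest cs I) ≤ cs.length w) : w = longest cs I := by
  have h1 := length_longest_mul cs hI (longest_mem cs I) (fun _ hv => length_le_longest cs I hv)
    (mul_mem (inv_mem (longest_mem cs I)) hw)
  rw [mul_inv_cancel_left] at h1
  have h2 : cs.length ((longest cs I)⁻¹ * w) = 0 := by omega
  rw [cs.length_eq_zero_iff] at h2
  exact (inv_mul_eq_one.1 h2).symm

theorem longest_inv {I : Set W} (hI : I ⊆ simples cs) : (longest cs I)⁻¹ = longest cs I :=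
  eq_longest hI (inv_mem (longest_mem cs I)) (by rw [cs.length_inv])

theorem longest_mul_self {I : Set W} (hI : I ⊆ simples cs) :
    longest cs I * longest cs I = 1 := by
  nth_rewrite 1 [← longest_inv hI]
  exact inv_mul_cancel _

theorem longest_mul_longest_mul_self {I : Set W} (hI : I ⊆ simples cs) (x : W) :
    x * longest cs I * longest cs I = x := by
  rw [mul_assoc, longest_mul_self hI, mul_one]

/-- `w_I` is the only element of `W_I` that has all elements of `I` as right descents. -/
theorem eq_longest_of_descents {I : Set W} (hI : I ⊆ simples cs) {w : W} (hw : w ∈ parabolic I)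
    (h : ∀ s ∈ I, cs.length (w * s) < cs.length w) : w = longest cs I := by
  have key : ∀ u ∈ parabolic I, cs.length (longest cs I * u) + cs.length u =
      cs.length (longest cs I) := fun u hu =>
    length_longest_mul cs hI (longest_mem cs I) (fun _ hv => length_le_longest cs I hv) hu
  have hm : (longest cs I)⁻¹ * w ∈ parabolic I := mul_mem (inv_mem (longest_mem cs I)) hw
  -- Since `ℓ(w_I v) = ℓ(w_I) - ℓ(v)` on `W_I`, right descents of `w` are right ascents of `w_I⁻¹
  -- w`.
  have h1 : (longest cs I)⁻¹ * w ∈ minReps cs I := by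
    intro s hs
    have h2 := key _ hm
    have h3 := key _ (mul_mem hm (Subgroup.subset_closure hs))
    have h4 := h s hs
    rw [mul_inv_cancel_left] at h2
    rw [← mul_assoc, mul_inv_cancel_left] at h3
    omega
  exact (inv_mul_eq_one.1 (eq_one_of_mem_minReps hI h1 hm)).symm

theorem length_longest_mul_lt {I : Set W} (hI : I ⊆ simples cs) {k : W} (hk : k ∈ I) :
    cs.length (longest cs I * k) < cs.length (longest cs I) := by
  have h1 := length_le_longest cs I (mul_mem (longest_mem cs I) (Subgroup.subset_closure hk))
  rcases length_mul_of_mem_simples (hI hk) (longest cs I) with h | h <;> omega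

theorem length_mul_longest_lt {I : Set W} (hI : I ⊆ simples cs) {k : W} (hk : k ∈ I) :
    cs.length (k * longest cs I) < cs.length (longest cs I) := by
  have h1 := length_le_longest cs I (mul_mem (Subgroup.subset_closure hk) (longest_mem cs I))
  rcases length_mul_of_mem_simples' (hI hk) (longest cs I) with h | h <;> omega

/-- The left descents of the longest element of a coset. -/
theorem length_mul_mul_longest_lt_iff {I : Set W} (hI : I ⊆ simples cs) {x j : W}
    (hx : x ∈ minReps cs I) (hj : j ∈ simples cs) :
    cs.length (j * (x * longest cs I)) < cs.length (x * longest cs I) ↔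
      cs.length (j * x) < cs.length x ∨ ∃ k ∈ I, j * x = x * k := by
  have hl := length_mul_of_minReps hI hx (longest_mem cs I)
  rw [← mul_assoc]
  constructor
  · intro h
    by_contra! hcon
    obtain ⟨h1, h2⟩ := hcon
    have h3 : cs.length x < cs.length (j * x) := by
      rcases length_mul_of_mem_simples' hj x with h | h <;> omega
    rcases simple_mul_mem_minReps hI hx hj h3 with h4 | ⟨k, hk, hjk⟩
    · have := length_mul_of_minReps hI h4 (longest_mem cs I)
      omega
    · exact h2 k hk hjk
  · rintro (h | ⟨k, hk, hjk⟩)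
    · have := cs.length_mul_le (j * x) (longest cs I)
      omega
    · rw [hjk, mul_assoc, length_mul_of_minReps hI hx
        (mul_mem (Subgroup.subset_closure hk) (longest_mem cs I))]
      have := length_mul_longest_lt hI hk
      omega

/-- The representative that occurs in the second type of relation is minimal in its coset. -/
theorem mul_longest_mul_longest_mem_minReps {I K : Set W} (hI : I ⊆ simples cs) (hK : K ⊆ I)
    {x : W} (hx : x ∈ minReps cs I) : x * longest cs I * longest cs K ∈ minReps cs K := by
  have hle : parabolic K ≤ parabolic I := Subgroup.closure_mono hK
  have hwI := longest_mem cs I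
  have hwK := longest_mem cs K
  have key : ∀ u ∈ parabolic I, cs.length (longest cs I * u) + cs.length u =
      cs.length (longest cs I) := fun u hu =>
    length_longest_mul cs hI hwI (fun _ hv => length_le_longest cs I hv) hu
  intro s hs
  have hs' : s ∈ parabolic I := Subgroup.subset_closure (hK hs)
  rw [mul_assoc, mul_assoc, length_mul_of_minReps hI hx (mul_mem hwI (hle hwK)),
    length_mul_of_minReps hI hx (mul_mem (mul_mem hwI (hle hwK)) hs'), mul_assoc]
  have h1 := key _ (hle hwK)
  have h2 := key _ (mul_mem (hle hwK) hs')
  have h3 := length_longest_mul_lt (hK.trans hI) hs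
  omega

end Finite

/-! ### The cosets `W_J` below a given coset -/

theorem coset_eq_of_mem {x y : W} {I : Set W} (hI : I ⊆ simples cs) (h : x⁻¹ * y ∈ parabolic I) :
    coset cs x I hI = coset cs y I hI := by
  apply Subtype.ext
  change x • (parabolic I : Set W) = y • (parabolic I : Set W)
  exact (leftCoset_eq_iff _).2 h

theorem exists_eq_coset (F : CoxeterComplex cs) :
    ∃ (I : Set W) (hI : I ⊆ simples cs), ∃ x ∈ minReps cs I, F = coset cs x I hI := by
  obtain ⟨A, I, hI, w, hA⟩ := F
  obtain ⟨x, hx, u, hu, rfl⟩ := exists_mul_minReps hI w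
  refine ⟨I, hI, x, hx, Eq.trans (Subtype.ext hA) (coset_eq_of_mem hI ?_).symm⟩
  simpa using hu

theorem mem_of_mem_simples_of_mem_parabolic {I : Set W} (hI : I ⊆ simples cs) {s : W}
    (hs : s ∈ simples cs) (hsI : s ∈ parabolic I) : s ∈ I := by
  obtain ⟨ω, h1, rfl, h3⟩ := exists_reduced_word hI hsI
  obtain ⟨i, hi⟩ := hs
  rw [← hi, cs.length_simple, List.length_eq_one_iff] at h3
  obtain ⟨j, rfl⟩ := h3
  simpa using h1 j (by simp)

theorem eq_of_parabolic_eq {I J : Set W} (hI : I ⊆ simples cs) (hJ : J ⊆ simples cs)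
    (h : (parabolic I : Set W) = (parabolic J : Set W)) : I = J := by
  have h' : parabolic I = parabolic J := SetLike.coe_injective h
  apply Set.Subset.antisymm
  · intro s hs
    exact mem_of_mem_simples_of_mem_parabolic hJ (hI hs) (h' ▸ Subgroup.subset_closure hs)
  · intro s hs
    exact mem_of_mem_simples_of_mem_parabolic hI (hJ hs) (h'.symm ▸ Subgroup.subset_closure hs)

theorem eq_one_of_coset_eq {y : W} {I J : Set W} (hI : I ⊆ simples cs) (hJ : J ⊆ simples cs)
    (hy : y ∈ minReps cs J) (h : coset cs 1 I hI = coset cs y J hJ) : y = 1 := by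
  have h1 : (1 : W) ∈ (coset cs y J hJ).1 := by
    rw [← h]
    exact ⟨1, one_mem _, by simp⟩
  obtain ⟨u, hu, hyu⟩ := h1
  apply eq_one_of_mem_minReps hJ hy
  rw [eq_inv_of_mul_eq_one_left hyu]
  exact inv_mem hu

/-- The simple left descents of the longest elements of a coset. -/
def leftDescents (F : CoxeterComplex cs) : Set W :=
  {j ∈ simples cs | ∃ m ∈ F.1, (∀ m' ∈ F.1, cs.length m' ≤ cs.length m) ∧
    cs.length (j * m) < cs.length m}

open Classical in
/-- The sign `(-1)^|J|` of a coset `W_J`, and zero for the other cosets. -/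
noncomputable def parabolicSign (F : CoxeterComplex cs) : ℤ :=
  if h : ∃ J, ∃ hJ : J ⊆ simples cs, F = coset cs 1 J hJ then (-1) ^ h.choose.ncard else 0

theorem coset_one_injective {I J : Set W} (hI : I ⊆ simples cs) (hJ : J ⊆ simples cs)
    (h : coset cs 1 I hI = coset cs 1 J hJ) : I = J := by
  have h' := congrArg Subtype.val h
  simp only [coset, one_smul] at h'
  exact eq_of_parabolic_eq hI hJ h'

theorem parabolicSign_coset_one {J : Set W} (hJ : J ⊆ simples cs) :
    parabolicSign (coset cs 1 J hJ) = (-1) ^ J.ncard := by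
  have h : ∃ K, ∃ hK : K ⊆ simples cs, coset cs 1 J hJ = coset cs 1 K hK := ⟨J, hJ, rfl⟩
  rw [parabolicSign, dif_pos h]
  obtain ⟨hK, he⟩ := h.choose_spec
  rw [← coset_one_injective hJ hK he]

theorem parabolicSign_eq_zero {y : W} {J : Set W} (hJ : J ⊆ simples cs)
    (hy : y ∈ minReps cs J) (hy1 : y ≠ 1) : parabolicSign (coset cs y J hJ) = 0 := by
  rw [parabolicSign, dif_neg]
  rintro ⟨K, hK, h⟩
  exact hy1 (eq_one_of_coset_eq hK hJ hy h.symm)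

/-! ### Left descents of cosets -/

variable [Finite W]

theorem mem_leftDescents_coset {I : Set W} (hI : I ⊆ simples cs) {x j : W}
    (hx : x ∈ minReps cs I) : j ∈ leftDescents (coset cs x I hI) ↔
      j ∈ simples cs ∧ cs.length (j * (x * longest cs I)) < cs.length (x * longest cs I) := by
  refine and_congr_right fun _ => ⟨?_, fun h => ⟨_, ⟨_, longest_mem cs I, rfl⟩, ?_, h⟩⟩
  · rintro ⟨_, ⟨u, hu, rfl⟩, hmax, h⟩
    simp only [smul_eq_mul] at hmax h
    have h1 := hmax _ ⟨_, longest_mem cs I, rfl⟩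
    simp only [smul_eq_mul] at h1
    rw [length_mul_of_minReps hI hx hu, length_mul_of_minReps hI hx (longest_mem cs I)] at h1
    rwa [← eq_longest hI hu (by omega)]
  · rintro _ ⟨u, hu, rfl⟩
    simp only [smul_eq_mul]
    rw [length_mul_of_minReps hI hx hu, length_mul_of_minReps hI hx (longest_mem cs I)]
    have := length_le_longest cs I hu
    omega

theorem mem_leftDescents_coset_iff {I : Set W} (hI : I ⊆ simples cs) {x j : W}
    (hx : x ∈ minReps cs I) : j ∈ leftDescents (coset cs x I hI) ↔
      j ∈ simples cs ∧ (cs.length (j * x) < cs.length x ∨ ∃ k ∈ I, j * x = x * k) := by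
  rw [mem_leftDescents_coset hI hx]
  exact and_congr_right fun hj => length_mul_mul_longest_lt_iff hI hx hj

theorem leftDescents_parabolic {I : Set W} (hI : I ⊆ simples cs) :
    leftDescents (coset cs 1 I hI) = I := by
  ext j
  rw [mem_leftDescents_coset_iff hI (one_mem_minReps hI)]
  simp only [mul_one, cs.length_one, not_lt_zero, one_mul, false_or, exists_eq_right']
  exact ⟨And.right, fun h => ⟨hI h, h⟩⟩

/-- A relation of the second type keeps the longest element `x w_I`. One of the first type keeps `x`
and enlarges `I`, which can only add descents by `mem_leftDescents_coset_iff`. -/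
theorem leftDescents_mono {F G : CoxeterComplex cs} (h : F ≤ G) :
    leftDescents F ⊆ leftDescents G := by
  induction (h : Relation.ReflTransGen (FacialCover cs) F G) with
  | refl => exact subset_rfl
  | tail _ hc ih =>
    refine ih.trans ?_
    cases hc with
    | up x s I hI hs hsI hx =>
      intro j
      rw [mem_leftDescents_coset_iff hI (minReps_anti (Set.subset_insert s I) hx),
        mem_leftDescents_coset_iff _ hx]
      rintro ⟨hj, h | ⟨k, hk, h⟩⟩
      exacts [⟨hj, Or.inl h⟩, ⟨hj, Or.inr ⟨k, Set.mem_insert_of_mem _ hk, h⟩⟩]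
    | down x s I hI hsI hx =>
      intro j
      rw [mem_leftDescents_coset hI hx, mem_leftDescents_coset _
        (mul_longest_mul_longest_mem_minReps hI Set.sdiff_subset hx),
        longest_mul_longest_mul_self (Set.sdiff_subset.trans hI)]
      exact id

/-! ### Going down to `W_J` -/

theorem FacialCover.le {F G : CoxeterComplex cs} (h : FacialCover cs F G) : F ≤ G :=
  Relation.ReflTransGen.single h

theorem coset_sdiff_le {x k : W} {I : Set W} (hI : I ⊆ simples cs) (hk : k ∈ I)
    (hx : x ∈ minReps cs I) :
    coset cs x (I \ {k}) (Set.sdiff_subset.trans hI) ≤ coset cs x I hI := by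
  have hins : insert k (I \ {k}) = I := by simp [Set.insert_eq_of_mem hk]
  have h := FacialCover.up (cs := cs) x k (I \ {k}) (Set.sdiff_subset.trans hI) (hI hk) (by simp)
    (by rwa [hins])
  refine h.le.trans (le_of_eq ?_)
  congr 1

/-- If `y w_K` has a right descent `r` outside `K`, then `y W_K` covers the coset of
`W_{K ∪ {r}}` with the same longest element. -/
theorem exists_coset_insert_le {y r : W} {K : Set W} (hK : K ⊆ simples cs)
    (hy : y ∈ minReps cs K) (hr : r ∈ simples cs) (hrK : r ∉ K)
    (hlt : cs.length (y * longest cs K * r) < cs.length (y * longest cs K)) :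
    ∃ x ∈ minReps cs (insert r K), cs.length x < cs.length y ∧
      x * longest cs (insert r K) = y * longest cs K ∧
      coset cs x (insert r K) (Set.insert_subset hr hK) ≤ coset cs y K hK := by
  have hI := Set.insert_subset hr hK
  obtain ⟨x, hx, u, hu, hxu⟩ := exists_mul_minReps hI (y * longest cs K)
  have hdesc : ∀ s ∈ insert r K, cs.length (u * s) < cs.length u := by
    intro s hs
    have h1 : cs.length (y * longest cs K * s) < cs.length (y * longest cs K) := by
      rcases hs with rfl | hs
      · exact hlt
      · rw [mul_assoc, length_mul_of_minReps hK hy (longest_mem cs K), length_mul_of_minReps hK hy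
          (mul_mem (longest_mem cs K) (Subgroup.subset_closure hs))]
        have := length_longest_mul_lt hK hs
        omega
    rw [hxu, mul_assoc, length_mul_of_minReps hI hx hu,
      length_mul_of_minReps hI hx (mul_mem hu (Subgroup.subset_closure hs))] at h1
    omega
  obtain rfl := eq_longest_of_descents hI hu hdesc
  have hsd : insert r K \ {r} = K := by simp [hrK]
  have hyx : x * longest cs (insert r K) * longest cs K = y := by
    rw [← hxu, longest_mul_longest_mul_self hK]
  have hc := FacialCover.down (cs := cs) x r _ hI (Set.mem_insert r K) hx
  refine ⟨x, hx, ?_, hxu.symm, ?_⟩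
  · have hle : parabolic K ≤ parabolic (insert r K) :=
      Subgroup.closure_mono (Set.subset_insert r K)
    rw [← hyx, mul_assoc]
    -- If `w_{K ∪ {r}} w_K = 1`, then `w_{K ∪ {r}} = w_K`, so `r` is a right descent of `w_K`, and
    -- exchange puts `r` into `W_K`, hence into `K`.
    refine length_lt_of_minReps cs hI hx (mul_mem hu (hle (longest_mem cs K))) fun h0 => hrK ?_
    refine mem_of_mem_simples_of_mem_parabolic hK hr ?_
    have h1 : longest cs (insert r K) ∈ parabolic K := by
      rw [eq_inv_of_mul_eq_one_left h0]
      exact inv_mem (longest_mem cs K)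
    have h2 : longest cs (insert r K) = longest cs K :=
      eq_longest hK h1 (length_le_longest cs _ (hle (longest_mem cs K)))
    have h3 : cs.length (longest cs K * r) < cs.length (longest cs K) := by
      have := length_longest_mul_lt hI (Set.mem_insert r K)
      rwa [h2] at this
    obtain ⟨i, rfl⟩ := hr
    obtain ⟨ω, h4, h5, -⟩ := exists_reduced_word hK (longest_mem cs K)
    rw [← h5] at h3
    obtain ⟨n, -, he⟩ := exchange cs ω i h3
    have h6 : longest cs K * cs.simple i ∈ parabolic K := by
      rw [← h5, he]
      exact wordProd_mem cs _ fun j hj => h4 j (List.mem_of_mem_eraseIdx hj)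
    exact (Subgroup.mul_mem_cancel_left _ (longest_mem cs K)).1 h6
  · refine hc.le.trans (le_of_eq ?_)
    apply Subtype.ext
    change (x * longest cs (insert r K) * longest cs (insert r K \ {r})) •
      (parabolic (insert r K \ {r}) : Set W) = y • (parabolic K : Set W)
    rw [hsd, hyx]

/-- If `y` normalizes `K` into a set of simple reflections, then the right descents of `y` are
right descents of `y w_K` outside `K`. -/
theorem length_mul_longest_mul_lt {y r : W} {K J : Set W} (hJ : J ⊆ simples cs)
    (hK : K ⊆ simples cs) (hy : y ∈ minReps cs K) (hconj : ∀ k ∈ K, y * k * y⁻¹ ∈ J)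
    (hr : cs.length (y * r) < cs.length y) :
    cs.length (y * longest cs K * r) < cs.length (y * longest cs K) := by
  -- Conjugation by `y` turns each letter of a reduced word of `w_K` into a simple reflection.
  have hlen : cs.length (y * longest cs K * y⁻¹) ≤ cs.length (longest cs K) := by
    obtain ⟨ω, h1, h2, h3⟩ := exists_reduced_word hK (longest_mem cs K)
    rw [← h3, ← h2]
    clear h2 h3
    induction ω with
    | nil => simp
    | cons i ω ih =>
      obtain ⟨j, hj⟩ := hJ (hconj _ (h1 i (by simp)))
      have h4 := ih fun k hk => h1 k (by simp [hk])
      have h5 := cs.length_mul_le (y * cs.simple i * y⁻¹) (y * cs.wordProd ω * y⁻¹)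
      have h6 : y * cs.simple i * y⁻¹ * (y * cs.wordProd ω * y⁻¹) =
          y * cs.wordProd (i :: ω) * y⁻¹ := by
        rw [cs.wordProd_cons]; group
      rw [h6] at h5
      rw [← hj, cs.length_simple] at h5
      simp only [List.length_cons]
      omega
  have h1 := cs.length_mul_le (y * longest cs K * y⁻¹) (y * r)
  have h2 : y * longest cs K * y⁻¹ * (y * r) = y * longest cs K * r := by group
  rw [h2] at h1
  rw [length_mul_of_minReps hK hy (longest_mem cs K)]
  omega

/-- Induction on `(ℓ(y), |K|)` in lexicographic order. If `y k y⁻¹ ∉ J` for some `k ∈ K`, then `k`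
can be dropped from `K`. Otherwise `y K y⁻¹ ⊆ J`: either `y = 1` and `K = J`, or a right descent of
`y` can be added to `K` without changing the longest element, which shortens the minimal
representative. -/
theorem parabolic_le_coset {J : Set W} (hJ : J ⊆ simples cs) {K : Set W} (hK : K ⊆ simples cs)
    {y : W} (hy : y ∈ minReps cs K) (h : J ⊆ leftDescents (coset cs y K hK)) :
    coset cs 1 J hJ ≤ coset cs y K hK := by
  by_cases hconj : ∃ k ∈ K, y * k * y⁻¹ ∉ J
  · obtain ⟨k, hk, hkJ⟩ := hconj
    have hy' := minReps_anti (Set.sdiff_subset (t := {k})) hy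
    -- No `j ∈ J` is lost as a left descent: `j y = y k` would give `y k y⁻¹ = j ∈ J`.
    refine (parabolic_le_coset hJ (Set.sdiff_subset.trans hK) hy' fun j hj => ?_).trans
      (coset_sdiff_le hK hk hy)
    have hjK := h hj
    rw [mem_leftDescents_coset_iff _ hy] at hjK
    rw [mem_leftDescents_coset_iff _ hy']
    obtain ⟨hjS, hlt | ⟨l, hl, hjl⟩⟩ := hjK
    · exact ⟨hjS, Or.inl hlt⟩
    · refine ⟨hjS, Or.inr ⟨l, ⟨hl, ?_⟩, hjl⟩⟩
      rintro rfl
      rw [← hjl, mul_inv_cancel_right] at hkJ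
      exact hkJ hj
  push Not at hconj
  by_cases hy1 : y = 1
  · subst hy1
    rw [leftDescents_parabolic] at h
    obtain rfl : J = K := h.antisymm fun k hk => by simpa using hconj k hk
    exact le_rfl
  · obtain ⟨i, hi⟩ := cs.exists_rightDescent_of_ne_one hy1
    have hiK : cs.simple i ∉ K := fun hmem => (hy _ hmem).asymm hi
    obtain ⟨x, hx, hxy, hmax, hle⟩ := exists_coset_insert_le hK hy ⟨i, rfl⟩ hiK
      (length_mul_longest_mul_lt hJ hK hy hconj hi)
    refine (parabolic_le_coset hJ _ hx fun j hj => ?_).trans hle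
    have hjK := h hj
    rwa [mem_leftDescents_coset _ hy, ← hmax, ← mem_leftDescents_coset _ hx] at hjK
termination_by (cs.length y, K.ncard)
decreasing_by
  · exact Prod.Lex.right _ (Set.ncard_sdiff_singleton_lt_of_mem hk)
  · exact Prod.Lex.left _ _ hxy

theorem parabolic_le_iff {J : Set W} (hJ : J ⊆ simples cs) (F : CoxeterComplex cs) :
    coset cs 1 J hJ ≤ F ↔ J ⊆ leftDescents F := by
  constructor
  · intro h
    have := leftDescents_mono h
    rwa [leftDescents_parabolic] at this
  · intro h
    obtain ⟨K, hK, y, hy, rfl⟩ := exists_eq_coset F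
    exact parabolic_le_coset hJ hK hy h

theorem eq_bot_of_leftDescents_eq_empty {F : CoxeterComplex cs} (h : leftDescents F = ∅) :
    F = coset cs 1 ∅ (Set.empty_subset _) := by
  obtain ⟨K, hK, y, hy, rfl⟩ := exists_eq_coset F
  have key : ∀ j, j ∈ simples cs → ¬ (cs.length (j * y) < cs.length y ∨ ∃ k ∈ K, j * y = y * k) :=
    fun j hj hcon => by
      have := (mem_leftDescents_coset_iff hK hy).2 ⟨hj, hcon⟩
      rw [h] at this
      exact this
  obtain rfl : y = 1 := by
    by_contra hy1
    obtain ⟨i, hi⟩ := cs.exists_leftDescent_of_ne_one hy1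
    exact key _ ⟨i, rfl⟩ (Or.inl hi)
  obtain rfl : K = ∅ := Set.eq_empty_iff_forall_notMem.2 fun k hk =>
    key k (hK hk) (Or.inr ⟨k, hk, by simp⟩)
  rfl

/-! ### The Möbius function -/

/-- The interval sums determine `f` recursively from `a` upwards, by the recursion that defines `μ`.
-/
theorem _root_.IncidenceAlgebra.mu_eq_of_sum_Icc {P : Type*} [PartialOrder P]
    [LocallyFiniteOrder P] [DecidableEq P] [Finite P] {a : P} {f : P → ℤ}
    (hf : ∀ b, a ≤ b → ∑ x ∈ Finset.Icc a b, f x = if a = b then 1 else 0) {b : P}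
    (hab : a ≤ b) : IncidenceAlgebra.mu ℤ a b = f b := by
  induction b using WellFoundedLT.induction with
  | _ b ih =>
    have h1 := hf b hab
    rw [← Finset.Ico_insert_right hab, Finset.sum_insert (by simp)] at h1
    rw [IncidenceAlgebra.mu_apply]
    split_ifs at h1 ⊢ with h
    · subst h
      simpa using h1.symm
    · rw [Finset.sum_congr rfl fun x hx =>
        ih x (Finset.mem_Ico.1 hx).2 (Finset.mem_Ico.1 hx).1]
      exact (eq_neg_of_add_eq_zero_left h1).symm

theorem bot_le_coset (F : CoxeterComplex cs) : coset cs 1 ∅ (Set.empty_subset _) ≤ F :=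
  (parabolic_le_iff _ F).2 (Set.empty_subset _)

theorem sum_parabolicSign (F : CoxeterComplex cs) :
    ∑ G ∈ Finset.Icc (coset cs 1 ∅ (Set.empty_subset _)) F, parabolicSign G =
      if coset cs 1 ∅ (Set.empty_subset _) = F then 1 else 0 := by
  classical
  have hS : leftDescents F ⊆ simples cs := fun _ h => h.1
  let D : Finset W := (Set.toFinite (leftDescents F)).toFinset
  have hD : ∀ J ∈ D.powerset, (J : Set W) ⊆ leftDescents F := fun J hJ j hj => by
    simpa [D] using Finset.mem_powerset.1 hJ hj
  have h1 : ∑ J ∈ D.powerset, (-1 : ℤ) ^ J.card =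
      ∑ G ∈ Finset.Icc (coset cs 1 ∅ (Set.empty_subset _)) F, parabolicSign G := by
    refine Finset.sum_of_injOn
      -- The value `F` is a dummy: every `J` in the sum lies in `D(F)`, hence consists of simple
      -- reflections.
      (fun J => if h : (J : Set W) ⊆ simples cs then coset cs 1 J h else F) ?_ ?_ ?_ ?_
    · intro I hI J hJ h
      have hI' := (hD I hI).trans hS
      have hJ' := (hD J hJ).trans hS
      simp only [hI', hJ', dif_pos] at h
      exact Finset.coe_injective (coset_one_injective hI' hJ' h)
    · intro J hJ
      have hJ' := (hD J hJ).trans hS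
      simp only [hJ', dif_pos, Finset.coe_Icc, Set.mem_Icc]
      exact ⟨bot_le_coset _, (parabolic_le_iff hJ' F).2 (hD J hJ)⟩
    -- A coset in the interval that is not in the image has `y ≠ 1`, so its sign is 0.
    · intro G hG hGn
      obtain ⟨K, hK, y, hy, rfl⟩ := exists_eq_coset G
      refine parabolicSign_eq_zero hK hy ?_
      rintro rfl
      refine hGn ⟨(Set.toFinite K).toFinset, ?_, ?_⟩
      · have := (parabolic_le_iff hK F).1 (Finset.mem_Icc.1 hG).2
        simpa [D] using this
      · simp [hK]
    · intro J hJ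
      have hJ' := (hD J hJ).trans hS
      simp only [hJ', dif_pos]
      rw [parabolicSign_coset_one, Set.ncard_coe_finset]
  rw [← h1, Finset.sum_powerset_neg_one_pow_card]
  refine if_congr ⟨fun h => (eq_bot_of_leftDescents_eq_empty ?_).symm, ?_⟩ rfl rfl
  · simpa [D] using h
  · rintro rfl
    simp [D, leftDescents_parabolic]

end FacialWeak

theorem mainTheorem9 {B W : Type*} [Group W] [Finite W] {M : CoxeterMatrix B}
    (cs : CoxeterSystem M W) (y : W) (J : Set W) (hJ : J ⊆ FacialWeak.simples cs)
    (hy : y ∈ FacialWeak.minReps cs J) :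
    (y = 1 →
      FacialWeak.facialMu cs
        (FacialWeak.coset cs 1 ∅ (Set.empty_subset _)) (FacialWeak.coset cs y J hJ) =
          (-1) ^ J.ncard) ∧
    (y ≠ 1 →
      FacialWeak.facialMu cs
        (FacialWeak.coset cs 1 ∅ (Set.empty_subset _)) (FacialWeak.coset cs y J hJ) = 0) := by
  rw [FacialWeak.facialMu, IncidenceAlgebra.mu_eq_of_sum_Icc
    (fun b _ => FacialWeak.sum_parabolicSign b) (FacialWeak.bot_le_coset _)]
  refine ⟨?_, FacialWeak.parabolicSign_eq_zero hJ hy⟩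
  rintro rfl
  exact FacialWeak.parabolicSign_coset_one hJ
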